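/- Let $(\mathbf{C},\otimes,I,\dagger)$ be a dagger compact closed category, that is, a symmetric monoidal category with an identity-on-objects involutive contravariant functor $\dagger$ (the hom sets being sets), such that $\otimes$ preserves $\dagger$, the associators, unitors and braidings are dagger isomorphisms ($m^{-1}=m^\dagger$), and each object $X$ has a dagger dual: an object $X^*$ and a morphism $\eta_X\colon I\to X^*\otimes X$ that satisfies, together with $(\beta_{X^*,X}\circ\eta_X)^\dagger\colon X\otimes X^*\to I$, where $\beta$ is the braiding, the two triangle identities of a duality. Assume that 1. each family $\{X_\alpha\}_{\alpha\in M}$ of objects indexed by a set has a dagger biproduct, i.e., an object with morphisms $i_\alpha$ from the $X_\alpha$ that make it a coproduct, such that the morphisms $i_\alpha^\dagger$ make it a product, $i_\alpha^\dagger\circ i_\alpha$ is an identity, and $i_\beta^\dagger\circ i_\alpha=0$ for $\alpha\neq\beta$ (in particular there is a zero object, and $0$ denotes the morphism that factors through it); 2. each morphism has a kernel $k$ that is dagger monic ($k^\dagger\circ k=\mathrm{id}$); 3. $k$ and $k^\perp$ are jointly epic for each dagger kernel $k$ (a dagger monic morphism that is a kernel of some morphism), where $k^\perp$ is a dagger monic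 kernel of $k^\dagger$; 4. $I$ is not a zero object; 5. each nonzero morphism $I\to I$ is invertible; 6. $I$ is a separator. For parallel morphisms $r,s\colon X\to Y$ put $r+s=\Delta_Y^\dagger\circ(r\oplus s)\circ\Delta_X$, where $\Delta_X\colon X\to X\oplus X$ is the diagonal, and write $r\le s$ if $r+s=s$; this is a partial order with least element $0$. Let $E(X)$ be the set of atoms of $\mathbf{C}(I,X)$ (the minimal nonzero elements), and for $r\colon X\to Y$ let $E(r)=\{(x,y)\in E(X)\times E(Y)\mid y^\dagger\circ r\circ x=1\}$, where $1=\mathrm{id}_I$. Then $E$ is a functor from $\mathbf{C}$ to the category $\mathbf{Rel}$ of sets and binary relations, and it is a strong symmetric monoidal functor $(\mathbf{C},\otimes,I)\to(\mathbf{Rel},\times,\{*\})$ with the following structure maps: the isomorphism $\{*\}\to E(I)$ is the function $*\mapsto 1$, and the natural isomorphism $E(X)\times E(Y)\to E(X\otimes Y)$ is the function $(x,y)\mapsto x\otimes y$ (composed with $I\cong I\otimes I$). In particular, $1\in E(I)$, $x\otimes y\in E(X\otimes Y)$ for all $x\in E(X)$ and $y\in E(Y)$, and the function $(x,y)\mapsto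 x\otimes y$ is a bijection. -/

import Mathlib

open CategoryTheory CategoryTheory.Limits CategoryTheory.MonoidalCategory

universe v u

/-! ### The symmetric monoidal category of sets and relations, with the Cartesian product

The category is Mathlib's `RelCat`. -/

namespace RelMon

/-- The underlying set of an object of `RelCat`. -/
def El (X : RelCat.{v}) : Type v := X

/-- A set, as an object of `RelCat`. -/
def of (A : Type v) : RelCat.{v} := A

/-- A relation, as a morphism of `RelCat`. -/
def ofRel {X Y : RelCat.{v}} (R : El X → El Y → Prop) : X ⟶ Y :=
  RelCat.Hom.ofRel {p : El X × El Y | R p.1 p.2}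

/-- `x` is related to `y` by the morphism `f` of `RelCat`. -/
def Related {X Y : RelCat.{v}} (f : X ⟶ Y) (x : El X) (y : El Y) : Prop :=
  ((x, y) : El X × El Y) ∈ RelCat.Hom.rel f

theorem hom_ext {X Y : RelCat.{v}} {f g : X ⟶ Y}
    (h : ∀ (x : El X) (y : El Y), Related f x y ↔ Related g x y) : f = g := by
  apply RelCat.Hom.ext
  apply Set.ext
  rintro ⟨a, b⟩
  exact h a b

theorem related_ofRel {X Y : RelCat.{v}} (R : El X → El Y → Prop) (x : El X) (y : El Y) :
    Related (ofRel R) x y ↔ R x y := Iff.rfl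

theorem related_id {X : RelCat.{v}} (x y : El X) : Related (𝟙 X) x y ↔ x = y := Iff.rfl

theorem related_comp {X Y Z : RelCat.{v}} (f : X ⟶ Y) (g : Y ⟶ Z) (x : El X) (z : El Z) :
    Related (f ≫ g) x z ↔ ∃ y : El Y, Related f x y ∧ Related g y z := Iff.rfl

/-- A function, regarded as a morphism of `RelCat` (its graph). -/
def graphHom {X Y : RelCat.{v}} (f : El X → El Y) : X ⟶ Y := ofRel (fun x y => f x = y)

theorem graph_comp {X Y Z : RelCat.{v}} (f : El X → El Y) (g : El Y → El Z) :
    graphHom f ≫ graphHom g = graphHom (fun x => g (f x)) := by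
  apply hom_ext
  intro x z
  rw [related_comp]
  simp only [graphHom, related_ofRel]
  simp

theorem graph_id (X : RelCat.{v}) : 𝟙 X = graphHom (fun x : El X => x) := rfl

/-- A bijection, regarded as an isomorphism of `RelCat`. -/
def equivIso {X Y : RelCat.{v}} (e : El X ≃ El Y) : X ≅ Y where
  hom := graphHom e
  inv := graphHom e.symm
  hom_inv_id := by rw [graph_comp, graph_id]; simp
  inv_hom_id := by rw [graph_comp, graph_id]; simp

/-- The Cartesian product of sets, as an object of `RelCat`. -/
def prodObj (X Y : RelCat.{v}) : RelCat.{v} := of (El X × El Y)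

/-- The one-point set, as an object of `RelCat`. -/
def unitObj : RelCat.{v} := of PUnit.{v + 1}

def pair {X Y : RelCat.{v}} (x : El X) (y : El Y) : El (prodObj X Y) := (x, y)

def fst {X Y : RelCat.{v}} (p : El (prodObj X Y)) : El X := Prod.fst p

def snd {X Y : RelCat.{v}} (p : El (prodObj X Y)) : El Y := Prod.snd p

theorem pair_eta {X Y : RelCat.{v}} (p : El (prodObj X Y)) : pair (fst p) (snd p) = p := rfl

theorem prod_ext {X Y : RelCat.{v}} (p q : El (prodObj X Y)) :
    p = q ↔ fst p = fst q ∧ snd p = snd q := Prod.ext_iff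

/-- The product of two relations: `(x, x')` is related to `(y, y')` when `x` is related to `y`
and `x'` is related to `y'`. -/
def prodHom {X Y X' Y' : RelCat.{v}} (f : X ⟶ Y) (g : X' ⟶ Y') :
    prodObj X X' ⟶ prodObj Y Y' :=
  ofRel (fun p q => Related f (fst p) (fst q) ∧ Related g (snd p) (snd q))

theorem prodHom_graph {X Y X' Y' : RelCat.{v}} (f : El X → El Y) (g : El X' → El Y') :
    prodHom (graphHom f) (graphHom g) =
      graphHom (fun p : El (prodObj X X') => pair (f (fst p)) (g (snd p))) := by
  apply hom_ext
  intro p q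
  exact (prod_ext (pair (f (fst p)) (g (snd p))) q).symm

theorem prodHom_id (X Y : RelCat.{v}) : prodHom (𝟙 X) (𝟙 Y) = 𝟙 (prodObj X Y) := by
  rw [graph_id, graph_id, prodHom_graph]
  rfl

theorem prodHom_comp {X Y Z X' Y' Z' : RelCat.{v}} (f : X ⟶ Y) (g : Y ⟶ Z)
    (f' : X' ⟶ Y') (g' : Y' ⟶ Z') :
    prodHom (f ≫ g) (f' ≫ g') = prodHom f f' ≫ prodHom g g' := by
  apply hom_ext
  intro p q
  constructor
  · rintro ⟨⟨y, h1, h2⟩, ⟨y', h3, h4⟩⟩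
    exact ⟨pair y y', ⟨h1, h3⟩, ⟨h2, h4⟩⟩
  · rintro ⟨y, ⟨h1, h3⟩, ⟨h2, h4⟩⟩
    exact ⟨⟨fst y, h1, h2⟩, ⟨snd y, h3, h4⟩⟩

/-- The associator `((x, y), z) ↦ (x, (y, z))`. -/
def assocIso (X Y Z : RelCat.{v}) : prodObj (prodObj X Y) Z ≅ prodObj X (prodObj Y Z) :=
  equivIso (Equiv.prodAssoc (El X) (El Y) (El Z))

/-- The left unitor `(*, x) ↦ x`. -/
def leftUnitIso (X : RelCat.{v}) : prodObj unitObj X ≅ X :=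
  equivIso (Equiv.punitProd (El X))

/-- The right unitor `(x, *) ↦ x`. -/
def rightUnitIso (X : RelCat.{v}) : prodObj X unitObj ≅ X :=
  equivIso (Equiv.prodPUnit (El X))

/-- The braiding `(x, y) ↦ (y, x)`. -/
def swapIso (X Y : RelCat.{v}) : prodObj X Y ≅ prodObj Y X :=
  equivIso (Equiv.prodComm (El X) (El Y))

/-- Naturality of functions in relations. -/
theorem comp_graph_eq {X Y X' Y' : RelCat.{v}} (f : X ⟶ Y) (g : X' ⟶ Y')
    (e : El X ≃ El X') (d : El Y ≃ El Y')
    (h : ∀ x y, Related f x y ↔ Related g (e x) (d y)) :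
    f ≫ (equivIso d).hom = (equivIso e).hom ≫ g := by
  apply hom_ext
  intro x y
  constructor
  · rintro ⟨z, h1, h2⟩
    obtain rfl : d z = y := h2
    exact ⟨e x, rfl, (h _ _).1 h1⟩
  · rintro ⟨z, h1, h2⟩
    obtain rfl : e x = z := h1
    refine ⟨d.symm y, (h _ _).2 ?_, d.apply_symm_apply y⟩
    rwa [d.apply_symm_apply]

instance : MonoidalCategory RelCat.{v} where
  tensorObj := prodObj
  whiskerLeft X _ _ f := prodHom (𝟙 X) f
  whiskerRight f Y := prodHom f (𝟙 Y)
  tensorHom f g := prodHom f g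
  tensorUnit := unitObj
  associator := assocIso
  leftUnitor := leftUnitIso
  rightUnitor := rightUnitIso
  tensorHom_def f g := by
    rw [← prodHom_comp, Category.comp_id, Category.id_comp]
  id_tensorHom_id := prodHom_id
  tensorHom_comp_tensorHom _ _ _ _ := (prodHom_comp _ _ _ _).symm
  whiskerLeft_id := prodHom_id
  id_whiskerRight := prodHom_id
  associator_naturality _ _ _ := comp_graph_eq _ _ _ _ fun _ _ => and_assoc
  leftUnitor_naturality _ := comp_graph_eq _ _ _ _ fun _ _ =>
    ⟨fun k => k.2, fun k => ⟨rfl, k⟩⟩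
  rightUnitor_naturality _ := comp_graph_eq _ _ _ _ fun _ _ =>
    ⟨fun k => k.1, fun k => ⟨k, rfl⟩⟩
  pentagon W X Y Z := by
    simp only [assocIso, equivIso, graph_id, prodHom_graph, graph_comp]
    rfl
  triangle X Y := by
    simp only [assocIso, leftUnitIso, rightUnitIso, equivIso, graph_id, prodHom_graph, graph_comp]
    rfl

theorem hexagon_aux (X Y Z : RelCat.{v}) :
    (assocIso X Y Z).hom ≫ (swapIso X (prodObj Y Z)).hom ≫ (assocIso Y Z X).hom =
      prodHom (swapIso X Y).hom (𝟙 Z) ≫ (assocIso Y X Z).hom ≫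
        prodHom (𝟙 Y) (swapIso X Z).hom := by
  simp only [assocIso, swapIso, equivIso, graph_id, prodHom_graph, graph_comp]
  rfl

theorem hexagon_aux' (X Y Z : RelCat.{v}) :
    (assocIso X Y Z).inv ≫ (swapIso (prodObj X Y) Z).hom ≫ (assocIso Z X Y).inv =
      prodHom (𝟙 X) (swapIso Y Z).hom ≫ (assocIso X Z Y).inv ≫
        prodHom (swapIso X Z).hom (𝟙 Y) := by
  simp only [assocIso, swapIso, equivIso, graph_id, prodHom_graph, graph_comp]
  rfl

theorem swap_swap (X Y : RelCat.{v}) :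
    (swapIso X Y).hom ≫ (swapIso Y X).hom = 𝟙 (prodObj X Y) := by
  simp only [swapIso, equivIso, graph_id, graph_comp]
  rfl

instance : SymmetricCategory RelCat.{v} where
  braiding := swapIso
  braiding_naturality_right _ _ _ _ := comp_graph_eq _ _ _ _ fun _ _ => and_comm
  braiding_naturality_left _ _ := comp_graph_eq _ _ _ _ fun _ _ => and_comm
  hexagon_forward := hexagon_aux
  hexagon_reverse := hexagon_aux'
  symmetry := swap_swap

end RelMon

/-! ### Dagger categories -/

/-- A dagger category. -/
class DaggerCategory (C : Type u) [Category.{v} C] where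
  dagger : ∀ {X Y : C}, (X ⟶ Y) → (Y ⟶ X)
  dagger_id : ∀ X : C, dagger (𝟙 X) = 𝟙 X
  dagger_dagger : ∀ {X Y : C} (f : X ⟶ Y), dagger (dagger f) = f
  dagger_comp : ∀ {X Y Z : C} (f : X ⟶ Y) (g : Y ⟶ Z), dagger (f ≫ g) = dagger g ≫ dagger f

namespace DaggerCategory

/-- A symmetric monoidal category with a dagger is dagger symmetric monoidal when its product is
a dagger functor and its associators, unitors and braidings are dagger isomorphisms. -/
class DaggerSymmetricMonoidal (C : Type u) [Category.{v} C] [MonoidalCategory C]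
    [SymmetricCategory C] [DaggerCategory C] : Prop where
  dagger_tensor : ∀ {X X' Y Y' : C} (f : X ⟶ Y) (g : X' ⟶ Y'),
    dagger (f ⊗ₘ g) = dagger f ⊗ₘ dagger g
  dagger_associator : ∀ X Y Z : C, dagger (α_ X Y Z).hom = (α_ X Y Z).inv
  dagger_leftUnitor : ∀ X : C, dagger (λ_ X).hom = (λ_ X).inv
  dagger_rightUnitor : ∀ X : C, dagger (ρ_ X).hom = (ρ_ X).inv
  dagger_braiding : ∀ X Y : C, dagger (β_ X Y).hom = (β_ X Y).inv

/-- An object `X` has a dagger dual if there are an object `Xs` and `η : I ⟶ Xs ⊗ X` such that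
`η` and the dagger of `I ⟶ Xs ⊗ X ≅ X ⊗ Xs` satisfy the two triangle identities (the identities
are those of `ExactPairing`). -/
def HasDaggerDual {C : Type u} [Category.{v} C] [MonoidalCategory C]
    [SymmetricCategory C] [DaggerCategory C] (X : C) : Prop :=
  ∃ (Xs : C) (p : ExactPairing Xs X),
    p.evaluation' = dagger (p.coevaluation' ≫ (β_ Xs X).hom)

/-- A dagger compact closed category: a dagger symmetric monoidal category in which every object
has a dagger dual. -/
class DaggerCompactClosed (C : Type u) [Category.{v} C] [MonoidalCategory C]
    [SymmetricCategory C] [DaggerCategory C] : Prop extends DaggerSymmetricMonoidal C where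
  hasDaggerDual : ∀ X : C, HasDaggerDual X

section Biproducts

variable {C : Type u} [Category.{v} C]

/-- `f` is a zero morphism: it factors through a zero object. -/
def FactorsThroughZero {X Y : C} (f : X ⟶ Y) : Prop :=
  ∃ Z : C, IsZero Z ∧ ∃ (a : X ⟶ Z) (b : Z ⟶ Y), f = a ≫ b

variable [DaggerCategory C]

/-- A dagger biproduct of a family of objects: an object with injections `inj a` that make it a
coproduct, whose daggers are projections that make it a product, such that
`(inj a)† ∘ inj a` is an identity and `(inj b)† ∘ inj a` is zero for `a ≠ b`. -/
structure DaggerBiproduct {M : Type v} (F : M → C) where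
  pt : C
  inj : ∀ a : M, F a ⟶ pt
  isColimit : IsColimit (Cofan.mk pt inj)
  isLimit : IsLimit (Fan.mk pt (fun a => dagger (inj a)))
  inj_self : ∀ a : M, inj a ≫ dagger (inj a) = 𝟙 (F a)
  inj_ne : ∀ a b : M, a ≠ b → FactorsThroughZero (inj a ≫ dagger (inj b))

namespace DaggerBiproduct

/-- The morphism `⨁ r_a : ⨁ X_a ⟶ ⨁ Y_a`. -/
def map {M : Type v} {F G : M → C} (bF : DaggerBiproduct F) (bG : DaggerBiproduct G)
    (r : ∀ a, F a ⟶ G a) : bF.pt ⟶ bG.pt :=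
  Cofan.IsColimit.desc bF.isColimit (fun a => r a ≫ bG.inj a)

/-- The diagonal `X ⟶ ⨁_{a ∈ M} X`. -/
def diag {M : Type v} {X : C} (b : DaggerBiproduct (fun _ : M => X)) : X ⟶ b.pt :=
  Fan.IsLimit.lift b.isLimit (fun _ => 𝟙 X)

end DaggerBiproduct

end Biproducts

/-- Every family of objects indexed by a set has a dagger biproduct. The index sets are those
in the universe of the sets of morphisms. -/
class HasDaggerBiproducts (C : Type u) [Category.{v} C] [DaggerCategory C] : Prop where
  exists_biproduct : ∀ {M : Type v} (F : M → C), Nonempty (DaggerBiproduct F)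

section Kernels

variable {C : Type u} [Category.{v} C] [DaggerCategory C] [HasDaggerBiproducts C]

/-- A choice of dagger biproduct. -/
noncomputable def daggerBiprod {M : Type v} (F : M → C) : DaggerBiproduct F :=
  (HasDaggerBiproducts.exists_biproduct F).some

/-- The biproduct of the empty family is a zero object. -/
instance : HasZeroObject C := by
  obtain ⟨b⟩ := HasDaggerBiproducts.exists_biproduct (C := C) (M := PEmpty.{v + 1})
    (fun a => a.elim)
  refine ⟨⟨b.pt, ⟨fun Y => ⟨⟨⟨Cofan.IsColimit.desc b.isColimit (fun a => a.elim)⟩, fun f => ?_⟩⟩,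
    fun Y => ⟨⟨⟨Fan.IsLimit.lift b.isLimit (fun a => a.elim)⟩, fun f => ?_⟩⟩⟩⟩⟩
  · exact Cofan.IsColimit.hom_ext b.isColimit _ _ (fun a => a.elim)
  · exact Fan.IsLimit.hom_ext b.isLimit _ _ (fun a => a.elim)

/-- The zero morphism `X ⟶ Y` is the unique one that factors through a zero object. -/
noncomputable instance : HasZeroMorphisms C := HasZeroObject.zeroMorphismsOfZeroObject

theorem factorsThroughZero_iff {X Y : C} (f : X ⟶ Y) : FactorsThroughZero f ↔ f = 0 := by
  constructor
  · rintro ⟨Z, hZ, a, b, rfl⟩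
    rw [hZ.eq_of_tgt a 0, zero_comp]
  · rintro rfl
    exact ⟨_, isZero_zero C, 0, 0, by simp⟩

/-- The sum of a family of parallel morphisms, `Δ† ∘ (⨁ r_a) ∘ Δ`. -/
noncomputable def homSum {M : Type v} {X Y : C} (r : M → (X ⟶ Y)) : X ⟶ Y :=
  (daggerBiprod (fun _ : M => X)).diag ≫
    (daggerBiprod (fun _ : M => X)).map (daggerBiprod (fun _ : M => Y)) r ≫
      dagger (daggerBiprod (fun _ : M => Y)).diag

/-- The sum of two parallel morphisms. -/
noncomputable def homAdd {X Y : C} (r s : X ⟶ Y) : X ⟶ Y :=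
  homSum (fun i : ULift.{v} Bool => if i.down then r else s)

/-- The order on parallel morphisms: `r ≤ s` when `r + s = s`. -/
def HomLE {X Y : C} (r s : X ⟶ Y) : Prop := homAdd r s = s

/-- An atom for this order, whose least element is the zero morphism: a nonzero morphism with
nothing strictly between it and zero. -/
def IsAtomHom {X Y : C} (a : X ⟶ Y) : Prop :=
  a ≠ 0 ∧ ∀ b : X ⟶ Y, HomLE b a → b = 0 ∨ b = a

/-- `m` is dagger monic: `m† ∘ m = id`. -/
def IsDaggerMonic {X Y : C} (m : X ⟶ Y) : Prop := m ≫ dagger m = 𝟙 X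

/-- `k` is a kernel of `f`. -/
def IsKernelOf {K X Y : C} (k : K ⟶ X) (f : X ⟶ Y) : Prop :=
  ∃ w : k ≫ f = 0, Nonempty (IsLimit (KernelFork.ofι k w))

/-- A dagger kernel: a dagger monic morphism that is a kernel of some morphism. -/
def IsDaggerKernel {K X : C} (k : K ⟶ X) : Prop :=
  IsDaggerMonic k ∧ ∃ (Y : C) (f : X ⟶ Y), IsKernelOf k f

/-- `k'` is a complement `k^⊥` of `k`: a dagger kernel of `k†`. -/
def IsComplement {K K' X : C} (k' : K' ⟶ X) (k : K ⟶ X) : Prop :=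
  IsDaggerMonic k' ∧ IsKernelOf k' (dagger k)

def JointlyEpic {K K' X : C} (k : K ⟶ X) (k' : K' ⟶ X) : Prop :=
  ∀ ⦃Z : C⦄ (f g : X ⟶ Z), k ≫ f = k ≫ g → k' ≫ f = k' ≫ g → f = g

end Kernels

/-! ### The functor `E` -/

section Atoms

variable {C : Type u} [Category.{v} C] [MonoidalCategory C] [DaggerCategory C]
  [HasDaggerBiproducts C]

/-- `E(X)`: the set of atoms of `C(I, X)`. -/
def atomObj (X : C) : RelCat.{v} := RelMon.of {x : 𝟙_ C ⟶ X // IsAtomHom x}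

/-- The morphism `I ⟶ X` underlying an element of `E(X)`. -/
def atomPoint {X : C} (x : RelMon.El (atomObj X)) : 𝟙_ C ⟶ X := Subtype.val x

/-- An atom of `C(I, X)`, as an element of `E(X)`. -/
def mkAtom {X : C} (x : 𝟙_ C ⟶ X) (hx : IsAtomHom x) : RelMon.El (atomObj X) := ⟨x, hx⟩

/-- `E(r) = {(x, y) | y† ∘ r ∘ x = 1}`. -/
def atomMap {X Y : C} (r : X ⟶ Y) : atomObj X ⟶ atomObj Y :=
  RelMon.ofRel (fun x y => atomPoint x ≫ r ≫ dagger (atomPoint y) = 𝟙 (𝟙_ C))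

/-- `E` as a functor, once the functor laws hold. -/
def atomFunctor (hid : ∀ X : C, atomMap (𝟙 X) = 𝟙 (atomObj X))
    (hcomp : ∀ {X Y Z : C} (r : X ⟶ Y) (s : Y ⟶ Z), atomMap (r ≫ s) = atomMap r ≫ atomMap s) :
    C ⥤ RelCat.{v} where
  obj X := atomObj X
  map r := atomMap r
  map_id := hid
  map_comp := hcomp

/-- `x ⊗ y : I ⟶ X ⊗ Y`, through `I ≅ I ⊗ I`. -/
def tensorPoint {X Y : C} (x : 𝟙_ C ⟶ X) (y : 𝟙_ C ⟶ Y) : 𝟙_ C ⟶ X ⊗ Y :=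
  (λ_ (𝟙_ C)).inv ≫ (x ⊗ₘ y)

/-- The function `{*} → E(I)`, `* ↦ 1`, once `1` is an atom. -/
def unitAtom (h : IsAtomHom (𝟙 (𝟙_ C))) :
    RelMon.El (𝟙_ RelCat.{v}) → RelMon.El (atomObj (𝟙_ C)) :=
  fun _ => mkAtom (𝟙 (𝟙_ C)) h

/-- The function `E(X) × E(Y) → E(X ⊗ Y)`, `(x, y) ↦ x ⊗ y`, once each `x ⊗ y` is an atom. -/
def tensorAtom
    (h : ∀ {X Y : C} (x : RelMon.El (atomObj X)) (y : RelMon.El (atomObj Y)),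
      IsAtomHom (tensorPoint (atomPoint x) (atomPoint y)))
    (X Y : C) : RelMon.El (atomObj X ⊗ atomObj Y) → RelMon.El (atomObj (X ⊗ Y)) :=
  fun p => mkAtom (tensorPoint (atomPoint (RelMon.fst p)) (atomPoint (RelMon.snd p)))
    (h (RelMon.fst p) (RelMon.snd p))

end Atoms

end DaggerCategory

open DaggerCategory

/-!
Since sums of morphisms are defined by biproducts, a nonzero countable sum `w` of copies of `𝟙 I`
satisfies `w + w = w`; cancelling `w` gives `1 + 1 = 1`, and cancelling the sum of all scalars
from its translate shows that `1` is the only nonzero scalar. As `I` separates, a morphism is then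
determined by which pairs of points it relates, i.e. the points of `X` behave as the elements of a
complete lattice with an orthogonality relation `y† ∘ x = 0`, and complementing a kernel produces a
nonzero common lower bound of any two points that are not orthogonal.

The main step is that every nonzero point `b` contains an atom. Let `r` be the sum of all
endomorphisms `x ∘ z†` with `z† ∘ x = 0`. Its trace is the sum of the scalars `z† ∘ x`, hence zero.
If there were no atom below `b`, then any two points that meet `b` could be separated by an
orthogonal pair below them, so that `b ∘ b† ≤ r` and `b† ∘ b = tr (b ∘ b†) ≤ tr r = 0`.
-/

namespace DaggerCategory

section Sums

variable {C : Type u} [Category.{v} C] [DaggerCategory C]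

theorem dagger_injective {X Y : C} {f g : X ⟶ Y} (h : dagger f = dagger g) : f = g := by
  rw [← dagger_dagger f, h, dagger_dagger]

namespace DaggerBiproduct

variable {M : Type v} {F G : M → C}

theorem inj_desc (b : DaggerBiproduct F) {Y : C} (r : ∀ a, F a ⟶ Y) (a : M) :
    b.inj a ≫ Cofan.IsColimit.desc b.isColimit r = r a :=
  Cofan.IsColimit.fac b.isColimit r a

theorem desc_ext (b : DaggerBiproduct F) {Y : C} {f g : b.pt ⟶ Y}
    (h : ∀ a, b.inj a ≫ f = b.inj a ≫ g) : f = g :=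
  Cofan.IsColimit.hom_ext b.isColimit _ _ h

theorem lift_ext (b : DaggerBiproduct F) {X : C} {f g : X ⟶ b.pt}
    (h : ∀ a, f ≫ dagger (b.inj a) = g ≫ dagger (b.inj a)) : f = g :=
  Fan.IsLimit.hom_ext b.isLimit _ _ h

theorem inj_map (bF : DaggerBiproduct F) (bG : DaggerBiproduct G) (r : ∀ a, F a ⟶ G a) (a : M) :
    bF.inj a ≫ bF.map bG r = r a ≫ bG.inj a :=
  inj_desc _ _ _

theorem diag_proj {X : C} (b : DaggerBiproduct (fun _ : M => X)) (a : M) :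
    b.diag ≫ dagger (b.inj a) = 𝟙 X :=
  Fan.IsLimit.fac b.isLimit _ a

theorem inj_codiag {X : C} (b : DaggerBiproduct (fun _ : M => X)) (a : M) :
    b.inj a ≫ dagger b.diag = 𝟙 X := by
  rw [← dagger_dagger (b.inj a), ← dagger_comp, diag_proj, dagger_id]

end DaggerBiproduct

variable [HasDaggerBiproducts C]

theorem dagger_zero (X Y : C) : dagger (0 : X ⟶ Y) = 0 := by
  rw [← factorsThroughZero_iff]
  exact ⟨_, isZero_zero C, dagger (0 : _ ⟶ Y), dagger (0 : X ⟶ _), by rw [← dagger_comp, comp_zero]⟩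

theorem dagger_eq_zero_iff {X Y : C} (f : X ⟶ Y) : dagger f = 0 ↔ f = 0 :=
  ⟨fun h => dagger_injective (h.trans (dagger_zero X Y).symm), fun h => h ▸ dagger_zero X Y⟩

theorem DaggerBiproduct.inj_proj_of_ne {M : Type v} {F : M → C} (b : DaggerBiproduct F) {i j : M}
    (h : i ≠ j) : b.inj i ≫ dagger (b.inj j) = 0 :=
  (factorsThroughZero_iff _).1 (b.inj_ne i j h)

open DaggerBiproduct

variable {M N : Type v} {X Y Z : C}

theorem homSum_eq (r : M → (X ⟶ Y)) :
    homSum r = (daggerBiprod (fun _ : M => X)).diag ≫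
      Cofan.IsColimit.desc (daggerBiprod (fun _ : M => X)).isColimit r := by
  rw [homSum]
  congr 1
  apply desc_ext
  intro a
  rw [← Category.assoc, inj_map, Category.assoc, inj_codiag, Category.comp_id, inj_desc]

theorem homSum_comp (r : M → (X ⟶ Y)) (g : Y ⟶ Z) : homSum r ≫ g = homSum (fun a => r a ≫ g) := by
  rw [homSum_eq, homSum_eq, Category.assoc]
  congr 1
  apply desc_ext
  intro a
  rw [← Category.assoc, inj_desc, inj_desc]

theorem homSum_eq_single (r : M → (X ⟶ Y)) (c : M) (h : ∀ a, a ≠ c → r a = 0) :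
    homSum r = r c := by
  have hdesc : Cofan.IsColimit.desc (daggerBiprod (fun _ : M => X)).isColimit r =
      dagger ((daggerBiprod (fun _ : M => X)).inj c) ≫ r c := by
    apply desc_ext
    intro a
    rw [inj_desc, ← Category.assoc]
    by_cases hac : a = c
    · rw [hac, inj_self, Category.id_comp]
    · rw [inj_proj_of_ne _ hac, zero_comp, h a hac]
  rw [homSum_eq, hdesc, ← Category.assoc, diag_proj, Category.id_comp]

theorem homSum_eq_zero {r : M → (X ⟶ Y)} (h : ∀ a, r a = 0) : homSum r = 0 := by
  have hr : r = fun _ => 𝟙 X ≫ 0 := funext fun a => (h a).trans comp_zero.symm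
  rw [hr, ← homSum_comp, comp_zero]

/- By naturality in the codomain, an operation on families is determined by its value on the
injections into the biproduct, which the projections detect. -/
theorem eq_comp_homSum_of_natural (g : Z ⟶ X) (L : ∀ Y : C, (M → (X ⟶ Y)) → (Z ⟶ Y))
    (natural : ∀ {Y Y' : C} (r : M → (X ⟶ Y)) (f : Y ⟶ Y'),
      L Y r ≫ f = L Y' (fun a => r a ≫ f))
    (single : ∀ (c : M) (d : M → (X ⟶ X)), d c = 𝟙 X → (∀ a, a ≠ c → d a = 0) → L X d = g)
    (r : M → (X ⟶ Y)) : L Y r = g ≫ homSum r := by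
  let b := daggerBiprod (fun _ : M => X)
  have hinj : L b.pt b.inj = g ≫ b.diag := by
    apply b.lift_ext
    intro c
    rw [natural, Category.assoc, diag_proj, Category.comp_id]
    exact single c _ (b.inj_self c) fun a hac => b.inj_proj_of_ne hac
  have hr : r = fun a => b.inj a ≫ Cofan.IsColimit.desc b.isColimit r :=
    funext fun a => (inj_desc b r a).symm
  rw [hr, ← natural, hinj, ← hr, Category.assoc, homSum_eq]

theorem eq_homSum_of_natural (L : ∀ Y : C, (M → (X ⟶ Y)) → (X ⟶ Y))
    (natural : ∀ {Y Y' : C} (r : M → (X ⟶ Y)) (f : Y ⟶ Y'),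
      L Y r ≫ f = L Y' (fun a => r a ≫ f))
    (single : ∀ (c : M) (d : M → (X ⟶ X)), d c = 𝟙 X → (∀ a, a ≠ c → d a = 0) → L X d = 𝟙 X)
    (r : M → (X ⟶ Y)) : L Y r = homSum r := by
  rw [eq_comp_homSum_of_natural (𝟙 X) L natural single, Category.id_comp]

theorem comp_homSum (g : Z ⟶ X) (r : M → (X ⟶ Y)) : g ≫ homSum r = homSum (fun a => g ≫ r a) := by
  refine (eq_comp_homSum_of_natural g (fun _ r => homSum (fun a => g ≫ r a)) (fun r f => ?_)
    (fun c d hc hd => ?_) r).symm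
  · simp only [homSum_comp, Category.assoc]
  · rw [homSum_eq_single _ c fun a hac => by rw [hd a hac, comp_zero], hc, Category.comp_id]

theorem homSum_equiv (e : M ≃ N) (r : N → (X ⟶ Y)) : homSum (fun a => r (e a)) = homSum r := by
  refine eq_homSum_of_natural (fun _ r => homSum (fun a => r (e a)))
    (fun r f => homSum_comp _ _) (fun c d hc hd => ?_) r
  rw [homSum_eq_single _ (e.symm c), e.apply_symm_apply, hc]
  exact fun a hac => hd _ fun h => hac (e.eq_symm_apply.2 h)

theorem homAdd_comp (r s : X ⟶ Y) (g : Y ⟶ Z) : homAdd r s ≫ g = homAdd (r ≫ g) (s ≫ g) := by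
  simp only [homAdd, homSum_comp, ite_comp]

theorem comp_homAdd (g : Z ⟶ X) (r s : X ⟶ Y) : g ≫ homAdd r s = homAdd (g ≫ r) (g ≫ s) := by
  simp only [homAdd, comp_homSum, comp_ite]

theorem homAdd_zero (r : X ⟶ Y) : homAdd r 0 = r := by
  rw [homAdd, homSum_eq_single _ ⟨true⟩]
  · rfl
  · rintro ⟨_ | _⟩ h
    · rfl
    · exact absurd rfl h

theorem zero_homAdd (r : X ⟶ Y) : homAdd 0 r = r := by
  rw [homAdd, homSum_eq_single _ ⟨false⟩]
  · rfl
  · rintro ⟨_ | _⟩ h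
    · exact absurd rfl h
    · rfl

theorem homSum_sumType (r : M ⊕ N → (X ⟶ Y)) :
    homSum r = homAdd (homSum fun a => r (.inl a)) (homSum fun b => r (.inr b)) := by
  refine (eq_homSum_of_natural
    (fun _ r => homAdd (homSum fun a => r (.inl a)) (homSum fun b => r (.inr b)))
    (fun r f => by simp only [homAdd_comp, homSum_comp]) (fun c d hc hd => ?_) r).symm
  rcases c with c | c
  · rw [homSum_eq_single (fun a => d (.inl a)) c fun a hac => hd _ (Sum.inl_injective.ne hac),
      homSum_eq_zero fun b => hd _ Sum.inr_ne_inl, homAdd_zero, hc]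
  · rw [homSum_eq_single (fun b => d (.inr b)) c fun b hbc => hd _ (Sum.inr_injective.ne hbc),
      homSum_eq_zero fun a => hd _ Sum.inl_ne_inr, zero_homAdd, hc]

theorem homLE_homSum (hX : HomLE (𝟙 X) (𝟙 X)) (r : M → (X ⟶ Y)) (c : M) :
    HomLE (r c) (homSum r) := by
  refine eq_homSum_of_natural (fun _ r => homAdd (r c) (homSum r))
    (fun r f => by simp only [homAdd_comp, homSum_comp]) (fun a d ha hd => ?_) r
  rw [homSum_eq_single d a hd, ha]
  by_cases hca : c = a
  · rw [hca, ha, hX]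
  · rw [hd c hca, zero_homAdd]

end Sums

section Kernels

variable {C : Type u} [Category.{v} C] [DaggerCategory C] [HasDaggerBiproducts C]

theorem IsKernelOf.exists_lift {K X Y Z : C} {k : K ⟶ X} {f : X ⟶ Y} (h : IsKernelOf k f)
    (g : Z ⟶ X) (hg : g ≫ f = 0) : ∃ l : Z ⟶ K, l ≫ k = g := by
  obtain ⟨w, ⟨hk⟩⟩ := h
  obtain ⟨l, hl⟩ := KernelFork.IsLimit.lift' hk g hg
  exact ⟨l, hl⟩

theorem IsComplement.homAdd_projection {K K' X : C} {k : K ⟶ X} {k' : K' ⟶ X}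
    (hk' : IsComplement k' k) (hk : IsDaggerMonic k) (h : JointlyEpic k k') :
    homAdd (dagger k ≫ k) (dagger k' ≫ k') = 𝟙 X := by
  obtain ⟨hk'k', hkk', -⟩ := hk'
  have hk'k : k ≫ dagger k' = 0 := by
    rw [← dagger_eq_zero_iff, dagger_comp, dagger_dagger, hkk']
  rw [IsDaggerMonic] at hk hk'k'
  apply h
  · rw [comp_homAdd, reassoc_of% hk, reassoc_of% hk'k, zero_comp, homAdd_zero, Category.comp_id]
  · rw [comp_homAdd, reassoc_of% hkk', reassoc_of% hk'k', zero_comp, zero_homAdd,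
      Category.comp_id]

end Kernels

/-- Every morphism has a dagger kernel, and dagger kernels are jointly epic with their complements.
This is what splits an object into a kernel and its orthogonal complement. -/
class HasOrthogonalKernels (C : Type u) [Category.{v} C] [DaggerCategory C]
    [HasDaggerBiproducts C] : Prop where
  exists_kernel : ∀ {X Y : C} (f : X ⟶ Y), ∃ (K : C) (k : K ⟶ X), IsDaggerMonic k ∧ IsKernelOf k f
  jointlyEpic : ∀ {K K' X : C} (k : K ⟶ X) (k' : K' ⟶ X),
    IsDaggerKernel k → IsComplement k' k → JointlyEpic k k'

section OrthogonalKernels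

variable {C : Type u} [Category.{v} C] [DaggerCategory C] [HasDaggerBiproducts C]
  [HasOrthogonalKernels C] {X Y : C}

/- Here `q` is the projection onto the kernel of `f`, and `p` the one onto its complement. -/
theorem exists_orthogonal_decomposition (f : X ⟶ Y) :
    ∃ q p : X ⟶ X, homAdd q p = 𝟙 X ∧ q ≫ f = 0 ∧
      ∀ {Z : C} (w : Z ⟶ X), w ≫ f = 0 → p ≫ dagger w = 0 := by
  obtain ⟨K, k, hk, hkf⟩ := HasOrthogonalKernels.exists_kernel f
  obtain ⟨K', k', hk'⟩ : ∃ (K' : C) (k' : K' ⟶ X), IsComplement k' k :=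
    HasOrthogonalKernels.exists_kernel (dagger k)
  have hepi : JointlyEpic k k' := HasOrthogonalKernels.jointlyEpic k k' ⟨hk, Y, f, hkf⟩ hk'
  refine ⟨dagger k ≫ k, dagger k' ≫ k', hk'.homAdd_projection hk hepi, ?_, fun w hw => ?_⟩
  · rw [Category.assoc, hkf.choose, comp_zero]
  · obtain ⟨l, rfl⟩ := hkf.exists_lift w hw
    rw [dagger_comp, Category.assoc, reassoc_of% hk'.2.choose, zero_comp, comp_zero]

theorem eq_zero_of_comp_dagger_self {f : X ⟶ Y} (h : f ≫ dagger f = 0) : f = 0 := by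
  obtain ⟨q, p, hqp, hq, hp⟩ := exists_orthogonal_decomposition (dagger f)
  rw [← dagger_eq_zero_iff, ← Category.id_comp (dagger f), ← hqp, homAdd_comp, hq, hp f h,
    homAdd_zero]

end OrthogonalKernels

/-- A nonzero object all of whose nonzero endomorphisms are invertible: the unit object of the
theorem is one, and its endomorphisms are called scalars. -/
class IsBrick {C : Type u} [Category.{v} C] [DaggerCategory C] [HasDaggerBiproducts C]
    (S : C) : Prop where
  not_isZero : ¬ IsZero S
  isIso_of_ne_zero : ∀ s : S ⟶ S, s ≠ 0 → IsIso s

section Scalars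

variable {C : Type u} [Category.{v} C] [DaggerCategory C] [HasDaggerBiproducts C]
  {S : C} [IsBrick S]

variable (S) in
theorem id_ne_zero : 𝟙 S ≠ 0 :=
  fun h => IsBrick.not_isZero ((IsZero.iff_id_eq_zero S).2 h)

variable (S) in
theorem homLE_id : HomLE (𝟙 S) (𝟙 S) := by
  let one (M : Type v) : M → (S ⟶ S) := fun _ => 𝟙 S
  let w : S ⟶ S := homSum (one (ULift ℕ))
  have one_add_w : homAdd (𝟙 S) w = w := by
    let e : PUnit.{v + 1} ⊕ ULift.{v} ℕ ≃ ULift.{v} ℕ :=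
      (Equiv.sumComm _ _).trans <| (Equiv.ulift.sumCongr (Equiv.refl _)).trans <|
        Equiv.natSumPUnitEquivNat.trans Equiv.ulift.symm
    have h := (homSum_sumType _).symm.trans (homSum_equiv e (one (ULift ℕ)))
    rwa [homSum_eq_single _ PUnit.unit fun a ha => absurd rfl ha] at h
  have w_add_w : homAdd w w = w := by
    let e : ULift.{v} ℕ ⊕ ULift.{v} ℕ ≃ ULift.{v} ℕ :=
      (Equiv.ulift.sumCongr Equiv.ulift).trans <|
        Equiv.natSumNatEquivNat.trans Equiv.ulift.symm
    exact (homSum_sumType _).symm.trans (homSum_equiv e (one (ULift ℕ)))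
  have w_ne_zero : w ≠ 0 := by
    intro hw
    rw [hw, homAdd_zero] at one_add_w
    exact id_ne_zero S one_add_w
  have := IsBrick.isIso_of_ne_zero w w_ne_zero
  rw [HomLE, ← cancel_epi w, comp_homAdd, Category.comp_id, w_add_w]

theorem homSum_ne_zero_iff {M : Type v} {Y : C} {r : M → (S ⟶ Y)} :
    homSum r ≠ 0 ↔ ∃ a, r a ≠ 0 := by
  refine ⟨fun h => ?_, fun ⟨a, ha⟩ h => ha ?_⟩
  · contrapose! h
    exact homSum_eq_zero h
  · simpa only [HomLE, h, homAdd_zero] using homLE_homSum (homLE_id S) r a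

theorem homAdd_ne_zero_iff {Y : C} {r s : S ⟶ Y} : homAdd r s ≠ 0 ↔ r ≠ 0 ∨ s ≠ 0 := by
  simp [homAdd, homSum_ne_zero_iff, or_comm]

theorem eq_id_of_ne_zero {s : S ⟶ S} (hs : s ≠ 0) : s = 𝟙 S := by
  let t : S ⟶ S := homSum fun f : S ⟶ S => f
  have ht : t ≠ 0 := homSum_ne_zero_iff.2 ⟨s, hs⟩
  have := IsBrick.isIso_of_ne_zero s hs
  have := IsBrick.isIso_of_ne_zero t ht
  have hts : t ≫ s = t := by
    rw [homSum_comp]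
    exact homSum_equiv ((asIso s).homToEquiv) fun f => f
  rw [← cancel_epi t, hts, Category.comp_id]

theorem eq_of_ne_zero_iff {s t : S ⟶ S} (h : s ≠ 0 ↔ t ≠ 0) : s = t := by
  by_cases hs : s = 0
  · rw [hs, not_not.1 fun ht => h.2 ht hs]
  · rw [eq_id_of_ne_zero hs, eq_id_of_ne_zero (h.1 hs)]

theorem comp_ne_zero_iff {s t : S ⟶ S} : s ≫ t ≠ 0 ↔ s ≠ 0 ∧ t ≠ 0 := by
  refine ⟨fun h => ⟨fun hs => h ?_, fun ht => h ?_⟩, fun ⟨hs, ht⟩ => ?_⟩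
  · rw [hs, zero_comp]
  · rw [ht, comp_zero]
  · rwa [eq_id_of_ne_zero hs, Category.id_comp]

theorem isAtomHom_id : IsAtomHom (𝟙 S) :=
  ⟨id_ne_zero S, fun _ _ => or_iff_not_imp_left.2 eq_id_of_ne_zero⟩

theorem comp_ne_zero_of_homLE {X Y : C} {x y : S ⟶ X} (h : HomLE x y) {g : X ⟶ Y}
    (hx : x ≫ g ≠ 0) : y ≫ g ≠ 0 := by
  rw [← show homAdd x y = y from h, homAdd_comp, homAdd_ne_zero_iff]
  exact Or.inl hx

end Scalars

section Meets

variable {C : Type u} [Category.{v} C] [DaggerCategory C] [HasDaggerBiproducts C] {S X Y : C}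

/-- Two points of `X`, i.e. morphisms from a fixed object to `X`, meet when they are not orthogonal.
For sets and relations this says that the two subsets have a common element. -/
def Meets (x y : S ⟶ X) : Prop := x ≫ dagger y ≠ 0

theorem Meets.symm {x y : S ⟶ X} (h : Meets x y) : Meets y x := by
  intro h'
  apply h
  rw [← dagger_eq_zero_iff, dagger_comp, dagger_dagger, h']

theorem Meets.ne_zero {x y : S ⟶ X} (h : Meets x y) : x ≠ 0 := by
  rintro rfl
  exact h zero_comp

theorem meets_comp_right {x : S ⟶ Y} {y : S ⟶ X} {f : X ⟶ Y} :
    Meets x (y ≫ f) ↔ Meets (x ≫ dagger f) y := by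
  rw [Meets, Meets, dagger_comp, Category.assoc]

theorem meets_iff [IsBrick S] {x y : S ⟶ X} : Meets x y ↔ x ≫ dagger y = 𝟙 S :=
  ⟨eq_id_of_ne_zero, fun h => by rw [Meets, h]; exact id_ne_zero S⟩

theorem meets_self [HasOrthogonalKernels C] {x : S ⟶ X} (hx : x ≠ 0) : Meets x x :=
  fun h => hx (eq_zero_of_comp_dagger_self h)

end Meets

section Iso

variable {C : Type u} [Category.{v} C] [DaggerCategory C] [HasDaggerBiproducts C] {S X Y : C}

theorem IsAtomHom.comp_iso {x : S ⟶ X} (hx : IsAtomHom x) (e : X ≅ Y) :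
    IsAtomHom (x ≫ e.hom) := by
  refine ⟨fun h => hx.1 ?_, fun b hb => ?_⟩
  · rw [← cancel_mono e.hom, h, zero_comp]
  · have hbx : HomLE (b ≫ e.inv) x := by
      rw [HomLE, ← cancel_mono e.hom, homAdd_comp, Category.assoc, e.inv_hom_id, Category.comp_id]
      exact hb
    simpa only [e.comp_inv_eq, zero_comp] using hx.2 _ hbx

end Iso

/-- A brick that separates morphisms, so that morphisms out of it may serve as points. -/
class IsSeparatingBrick {C : Type u} [Category.{v} C] [DaggerCategory C] [HasDaggerBiproducts C]
    (S : C) : Prop extends IsBrick S where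
  isSeparator : IsSeparator S

section Points

variable {C : Type u} [Category.{v} C] [DaggerCategory C] [HasDaggerBiproducts C]
  {S : C} [IsSeparatingBrick S] {X Y : C}

variable (S) in
theorem hom_ext_of_points {f g : X ⟶ Y} (h : ∀ x : S ⟶ X, x ≫ f = x ≫ g) : f = g :=
  (isSeparator_def _).1 IsSeparatingBrick.isSeparator f g h

variable (S) in
theorem hom_ext_of_copoints {f g : X ⟶ Y} (h : ∀ y : S ⟶ Y, f ≫ dagger y = g ≫ dagger y) :
    f = g := by
  refine dagger_injective (hom_ext_of_points S fun y => dagger_injective ?_)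
  rw [dagger_comp, dagger_comp, dagger_dagger, dagger_dagger, h]

theorem homLE_of_forall_point {f g : X ⟶ Y} (h : ∀ x : S ⟶ X, HomLE (x ≫ f) (x ≫ g)) :
    HomLE f g :=
  hom_ext_of_points S fun x => (comp_homAdd x f g).trans (h x)

theorem homLE_iff_forall_meets {x y : S ⟶ X} : HomLE x y ↔ ∀ z, Meets x z → Meets y z := by
  refine ⟨fun h _ => comp_ne_zero_of_homLE h, fun h => hom_ext_of_copoints S fun z => ?_⟩
  apply eq_of_ne_zero_iff
  rw [homAdd_comp, homAdd_ne_zero_iff]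
  exact or_iff_right_of_imp (h z)

theorem HomLE.refl (x : S ⟶ X) : HomLE x x := homLE_iff_forall_meets.2 fun _ => id

theorem HomLE.trans {x y z : S ⟶ X} (hxy : HomLE x y) (hyz : HomLE y z) : HomLE x z :=
  homLE_iff_forall_meets.2 fun _ h => comp_ne_zero_of_homLE hyz (comp_ne_zero_of_homLE hxy h)

theorem HomLE.antisymm {x y : S ⟶ X} (hxy : HomLE x y) (hyx : HomLE y x) : x = y :=
  hom_ext_of_copoints S fun _ =>
    eq_of_ne_zero_iff ⟨comp_ne_zero_of_homLE hxy, comp_ne_zero_of_homLE hyx⟩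

theorem Meets.mono {x y x' y' : S ⟶ X} (h : Meets x y) (hx : HomLE x x') (hy : HomLE y y') :
    Meets x' y' :=
  Meets.symm <| comp_ne_zero_of_homLE hy <| Meets.symm <| comp_ne_zero_of_homLE hx h

end Points

section Atoms

variable {C : Type u} [Category.{v} C] [DaggerCategory C] [HasDaggerBiproducts C]
  [HasOrthogonalKernels C] {S : C} [IsSeparatingBrick S] {X Y : C}

theorem meets_of_homLE {x y : S ⟶ X} (hx : x ≠ 0) (h : HomLE x y) : Meets x y :=
  (meets_self hx).mono (.refl x) h

theorem exists_homLE_of_meets {x y : S ⟶ X} (h : Meets x y) :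
    ∃ z, z ≠ 0 ∧ HomLE z x ∧ HomLE z y := by
  obtain ⟨q, p, hqp, hq, hp⟩ := exists_orthogonal_decomposition (dagger x)
  have hy : homAdd (y ≫ q) (y ≫ p) = y := by rw [← comp_homAdd, hqp, Category.comp_id]
  have hzx : Meets (y ≫ p) x := by
    have hyx := h.symm
    rwa [Meets, ← hy, homAdd_comp, Category.assoc, hq, comp_zero, zero_homAdd] at hyx
  refine ⟨y ≫ p, hzx.ne_zero, homLE_iff_forall_meets.2 fun w hw => ?_,
    homLE_iff_forall_meets.2 fun w hw => ?_⟩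
  · refine Meets.symm fun hwx => hw ?_
    rw [Category.assoc, hp w hwx, comp_zero]
  · rw [Meets, ← hy, homAdd_comp, homAdd_ne_zero_iff]
    exact Or.inr hw

theorem IsAtomHom.homLE_of_meets {a x : S ⟶ X} (ha : IsAtomHom a) (h : Meets a x) :
    HomLE a x := by
  obtain ⟨z, hz, hza, hzx⟩ := exists_homLE_of_meets h
  exact (ha.2 z hza).resolve_left hz ▸ hzx

theorem IsAtomHom.meets_iff_eq {x y : S ⟶ X} (hx : IsAtomHom x) (hy : IsAtomHom y) :
    Meets x y ↔ x = y :=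
  ⟨fun h => (hx.homLE_of_meets h).antisymm (hy.homLE_of_meets h.symm),
    fun h => h ▸ meets_self hx.1⟩

theorem exists_orthogonal_of_not_isAtomHom {x : S ⟶ X} (hx : x ≠ 0) (h : ¬ IsAtomHom x) :
    ∃ y z, y ≠ 0 ∧ z ≠ 0 ∧ HomLE y x ∧ HomLE z x ∧ ¬ Meets y z := by
  obtain ⟨y, hyx, hy, hne⟩ : ∃ y, HomLE y x ∧ y ≠ 0 ∧ y ≠ x := by
    simpa only [IsAtomHom, not_and, hx, not_false_eq_true, true_imp_iff, not_forall, not_or,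
      exists_prop, ne_eq] using h
  obtain ⟨w, hxw, hyw⟩ : ∃ w, Meets x w ∧ ¬ Meets y w := by
    by_contra! h'
    exact hne (hyx.antisymm (homLE_iff_forall_meets.2 h'))
  obtain ⟨z, hz, hzx, hzw⟩ := exists_homLE_of_meets hxw
  exact ⟨y, z, hy, hz, hyx, hzx, fun hyz => hyw (hyz.mono (.refl y) hzw)⟩

theorem exists_orthogonal_meets_of_not_isAtomHom {b y w : S ⟶ X}
    (hb : ∀ a, IsAtomHom a → ¬ HomLE a b) (hy : Meets b y) (hw : Meets b w) :
    ∃ x z, ¬ Meets x z ∧ Meets x y ∧ Meets z w := by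
  obtain ⟨c, hc, hcb, hcw⟩ := exists_homLE_of_meets hw
  obtain ⟨z₁, z₂, hz₁, hz₂, hz₁c, hz₂c, hz⟩ :=
    exists_orthogonal_of_not_isAtomHom hc fun h => hb c h hcb
  by_cases hyz : Meets y z₁
  · obtain ⟨x, hx, hxy, hxz⟩ := exists_homLE_of_meets hyz
    exact ⟨x, z₂, fun h => hz (h.mono hxz (.refl z₂)), meets_of_homLE hx hxy,
      meets_of_homLE hz₂ (hz₂c.trans hcw)⟩
  · exact ⟨y, z₁, hyz, meets_self hy.symm.ne_zero, meets_of_homLE hz₁ (hz₁c.trans hcw)⟩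

end Atoms

section Coherence

variable {C : Type u} [Category.{v} C] [MonoidalCategory C] {X Y Z X' Y' : C}

theorem tensorPoint_eq_left (x : 𝟙_ C ⟶ X) (y : 𝟙_ C ⟶ Y) :
    tensorPoint x y = y ≫ (λ_ Y).inv ≫ x ▷ Y := by
  rw [tensorPoint, leftUnitor_inv_naturality_assoc, MonoidalCategory.whisker_exchange,
    ← MonoidalCategory.tensorHom_def]

theorem tensorPoint_eq_right (x : 𝟙_ C ⟶ X) (y : 𝟙_ C ⟶ Y) :
    tensorPoint x y = x ≫ (ρ_ X).inv ≫ X ◁ y := by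
  rw [tensorPoint, rightUnitor_inv_naturality_assoc, MonoidalCategory.tensorHom_def,
    unitors_inv_equal]

theorem tensorPoint_comp (x : 𝟙_ C ⟶ X) (y : 𝟙_ C ⟶ Y) (f : X ⟶ X') (g : Y ⟶ Y') :
    tensorPoint x y ≫ (f ⊗ₘ g) = tensorPoint (x ≫ f) (y ≫ g) := by
  rw [tensorPoint, tensorPoint, Category.assoc, tensorHom_comp_tensorHom]

theorem tensorPoint_whiskerRight (x : 𝟙_ C ⟶ X) (y : 𝟙_ C ⟶ Y) (f : X ⟶ X') :
    tensorPoint x y ≫ f ▷ Y = x ≫ f ≫ (ρ_ X').inv ≫ X' ◁ y := by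
  rw [← tensorHom_id, tensorPoint_comp, Category.comp_id, tensorPoint_eq_right, Category.assoc]

theorem tensorPoint_scalar (s t : 𝟙_ C ⟶ 𝟙_ C) :
    tensorPoint s t ≫ (λ_ (𝟙_ C)).hom = t ≫ s := by
  rw [tensorPoint_eq_left, Category.assoc, Category.assoc, unitors_equal, rightUnitor_naturality,
    ← unitors_equal, Iso.inv_hom_id_assoc]

theorem tensorPoint_associator (x : 𝟙_ C ⟶ X) (y : 𝟙_ C ⟶ Y) (z : 𝟙_ C ⟶ Z) :
    tensorPoint (tensorPoint x y) z ≫ (α_ X Y Z).hom = tensorPoint x (tensorPoint y z) := by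
  simp [tensorPoint, MonoidalCategory.tensorHom_def, unitors_inv_equal]

theorem tensorPoint_leftUnitor (x : 𝟙_ C ⟶ X) : tensorPoint (𝟙 _) x ≫ (λ_ X).hom = x := by
  simp [tensorPoint_eq_left]

theorem tensorPoint_rightUnitor (x : 𝟙_ C ⟶ X) : tensorPoint x (𝟙 _) ≫ (ρ_ X).hom = x := by
  simp [tensorPoint_eq_right]

theorem tensorPoint_braiding [BraidedCategory C] (x : 𝟙_ C ⟶ X) (y : 𝟙_ C ⟶ Y) :
    tensorPoint x y ≫ (β_ X Y).hom = tensorPoint y x := by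
  rw [tensorPoint, tensorPoint, Category.assoc, BraidedCategory.braiding_naturality,
    braiding_tensorUnit_left]
  simp [unitors_equal]

theorem rightUnitor_inv_mate_evaluation [HasLeftDual X] (f : X ⟶ 𝟙_ C) :
    (ρ_ X).inv ≫ X ◁ (η_ (ᘁX) X ≫ (ᘁX) ◁ f ≫ (ρ_ (ᘁX)).hom) ≫ ε_ (ᘁX) X = f := by
  have h := (tensorLeftHomEquiv (𝟙_ C) (ᘁX) X (𝟙_ C)).symm_apply_apply ((ρ_ X).hom ≫ f)
  rw [← cancel_epi (ρ_ X).hom, ← h]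
  simp [tensorLeftHomEquiv, unitors_equal]

end Coherence

section OffDiagonal

variable {C : Type u} [Category.{v} C] [MonoidalCategory C] [DaggerCategory C]
  [HasDaggerBiproducts C] {X : C}

variable (X) in
/-- The sum of the endomorphisms `x ∘ z†` over all pairs of orthogonal points. For sets and
relations this is the complement of the identity relation. -/
noncomputable def offDiagonal : X ⟶ X :=
  homSum fun q : {q : (𝟙_ C ⟶ X) × (𝟙_ C ⟶ X) // ¬ Meets q.1 q.2} => dagger q.1.2 ≫ q.1.1

theorem homLE_offDiagonal [HasOrthogonalKernels C] [IsSeparatingBrick (𝟙_ C)] {b : 𝟙_ C ⟶ X}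
    (hb : ∀ a, IsAtomHom a → ¬ HomLE a b) :
    HomLE (dagger b ≫ b) (offDiagonal X) := by
  refine homLE_of_forall_point fun u : 𝟙_ C ⟶ X => homLE_iff_forall_meets.2 fun w h => ?_
  have hub : (u ≫ dagger b) ≫ (b ≫ dagger w) ≠ 0 := by
    simpa only [Meets, Category.assoc] using h
  obtain ⟨hu, hw⟩ := comp_ne_zero_iff.1 hub
  obtain ⟨x, z, hxz, hxw, hzu⟩ := exists_orthogonal_meets_of_not_isAtomHom hb hw (Meets.symm hu)
  rw [Meets, offDiagonal, comp_homSum, homSum_comp, homSum_ne_zero_iff]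
  refine ⟨⟨(x, z), hxz⟩, ?_⟩
  simpa only [Category.assoc] using comp_ne_zero_iff.2 ⟨hzu.symm, hxw⟩

end OffDiagonal

section Trace

variable {C : Type u} [Category.{v} C] [MonoidalCategory C] [BraidedCategory C]
  {X : C} [HasLeftDual X]

/-- The trace of an endomorphism of an object with a dual, formed with the braiding. -/
def trace (r : X ⟶ X) : 𝟙_ C ⟶ 𝟙_ C :=
  η_ (ᘁX) X ≫ (β_ (ᘁX) X).hom ≫ r ▷ (ᘁX) ≫ ε_ (ᘁX) X

theorem trace_comp_point (f : X ⟶ 𝟙_ C) (x : 𝟙_ C ⟶ X) : trace (f ≫ x) = x ≫ f := by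
  let s : 𝟙_ C ⟶ ᘁX := η_ (ᘁX) X ≫ (ᘁX) ◁ f ≫ (ρ_ (ᘁX)).hom
  calc trace (f ≫ x)
    _ = η_ (ᘁX) X ≫ ((β_ (ᘁX) X).hom ≫ f ▷ (ᘁX)) ≫ x ▷ (ᘁX) ≫ ε_ (ᘁX) X := by
      simp only [trace, comp_whiskerRight, Category.assoc]
    _ = tensorPoint x s ≫ ε_ (ᘁX) X := by
      rw [← BraidedCategory.braiding_naturality_right, braiding_tensorUnit_right,
        tensorPoint_eq_left]
      simp only [s, Category.assoc]
    _ = x ≫ f := by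
      rw [tensorPoint_eq_right, Category.assoc, Category.assoc, rightUnitor_inv_mate_evaluation]

end Trace

section TensorExt

variable {C : Type u} [Category.{v} C] [MonoidalCategory C] [DaggerCategory C]
  [HasDaggerBiproducts C] [IsSeparatingBrick (𝟙_ C)] {X Y Z : C} [HasLeftDual X]

theorem tensor_hom_ext {f g : X ⊗ Y ⟶ Z}
    (h : ∀ (x : 𝟙_ C ⟶ X) (y : 𝟙_ C ⟶ Y), tensorPoint x y ≫ f = tensorPoint x y ≫ g) :
    f = g := by
  apply (tensorLeftHomEquiv Y (ᘁX) X Z).injective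
  refine hom_ext_of_points (𝟙_ C) fun y => ?_
  apply (tensorLeftHomEquiv (𝟙_ C) (ᘁX) X Z).symm.injective
  rw [tensorLeftHomEquiv_symm_naturality, tensorLeftHomEquiv_symm_naturality,
    Equiv.symm_apply_apply, Equiv.symm_apply_apply, ← cancel_epi (ρ_ X).inv]
  refine hom_ext_of_points (𝟙_ C) fun x => ?_
  simpa only [tensorPoint_eq_right, Category.assoc] using h x y

theorem homLE_of_meets_tensorPoint {f g : 𝟙_ C ⟶ X ⊗ Y}
    (h : ∀ (x : 𝟙_ C ⟶ X) (y : 𝟙_ C ⟶ Y), Meets f (tensorPoint x y) → Meets g (tensorPoint x y)) :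
    HomLE f g := by
  refine dagger_injective (tensor_hom_ext fun x y => dagger_injective ?_)
  rw [dagger_comp, dagger_comp, dagger_dagger, dagger_dagger, homAdd_comp]
  apply eq_of_ne_zero_iff
  rw [homAdd_ne_zero_iff]
  exact or_iff_right_of_imp (h x y)

theorem exists_meets_tensorPoint {z : 𝟙_ C ⟶ X ⊗ Y} (hz : z ≠ 0) :
    ∃ (x : 𝟙_ C ⟶ X) (y : 𝟙_ C ⟶ Y), Meets z (tensorPoint x y) := by
  by_contra! h
  have hz0 : HomLE z 0 := homLE_of_meets_tensorPoint fun x y hxy => absurd hxy (h x y)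
  exact hz ((homAdd_zero z).symm.trans hz0)

theorem homSum_whiskerRight {M : Type v} (r : M → (X ⟶ Z)) (Y : C) :
    homSum r ▷ Y = homSum fun a => r a ▷ Y := by
  refine tensor_hom_ext fun x y => ?_
  simp only [comp_homSum, tensorPoint_whiskerRight, homSum_comp]

end TensorExt

section Atomicity

variable {C : Type u} [Category.{v} C] [MonoidalCategory C] [BraidedCategory C]
  [DaggerCategory C] [HasDaggerBiproducts C] [IsSeparatingBrick (𝟙_ C)] {X : C} [HasLeftDual X]

theorem trace_homSum {M : Type v} (r : M → (X ⟶ X)) :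
    trace (homSum r) = homSum fun a => trace (r a) := by
  simp only [trace, homSum_whiskerRight, homSum_comp, comp_homSum]

theorem trace_ne_zero_of_homLE {r s : X ⟶ X} (h : HomLE r s) (hr : trace r ≠ 0) : trace s ≠ 0 := by
  rw [← show homAdd r s = s from h, homAdd, trace_homSum, homSum_ne_zero_iff]
  exact ⟨⟨true⟩, hr⟩

variable (X) in
theorem trace_offDiagonal : trace (offDiagonal X) = 0 := by
  rw [offDiagonal, trace_homSum]
  refine homSum_eq_zero fun q => ?_
  rw [trace_comp_point]
  exact not_not.1 q.2

variable [HasOrthogonalKernels C]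

theorem exists_isAtomHom_homLE {b : 𝟙_ C ⟶ X} (hb : b ≠ 0) : ∃ a, IsAtomHom a ∧ HomLE a b := by
  by_contra! h
  refine trace_ne_zero_of_homLE (homLE_offDiagonal h) ?_ (trace_offDiagonal X)
  rw [trace_comp_point]
  exact meets_self hb

theorem exists_isAtomHom_of_meets {x y : 𝟙_ C ⟶ X} (h : Meets x y) :
    ∃ a, IsAtomHom a ∧ Meets x a ∧ Meets a y := by
  obtain ⟨z, hz, hzx, hzy⟩ := exists_homLE_of_meets h
  obtain ⟨a, ha, haz⟩ := exists_isAtomHom_homLE hz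
  exact ⟨a, ha, (meets_of_homLE ha.1 (haz.trans hzx)).symm, meets_of_homLE ha.1 (haz.trans hzy)⟩

end Atomicity

section TensorAtoms

variable {C : Type u} [Category.{v} C] [MonoidalCategory C] [SymmetricCategory C]
  [DaggerCategory C] [DaggerSymmetricMonoidal C] {X Y : C}

theorem tensorPoint_comp_dagger (x x' : 𝟙_ C ⟶ X) (y y' : 𝟙_ C ⟶ Y) :
    tensorPoint x y ≫ dagger (tensorPoint x' y') = (y ≫ dagger y') ≫ (x ≫ dagger x') := by
  have hdagger : dagger (tensorPoint x' y') = (dagger x' ⊗ₘ dagger y') ≫ (λ_ (𝟙_ C)).hom := by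
    rw [tensorPoint, dagger_comp, DaggerSymmetricMonoidal.dagger_tensor,
      ← DaggerSymmetricMonoidal.dagger_leftUnitor, dagger_dagger]
  rw [hdagger, ← Category.assoc, tensorPoint_comp, tensorPoint_scalar]

variable [HasDaggerBiproducts C]

theorem meets_tensorPoint [IsBrick (𝟙_ C)] {x x' : 𝟙_ C ⟶ X} {y y' : 𝟙_ C ⟶ Y} :
    Meets (tensorPoint x y) (tensorPoint x' y') ↔ Meets x x' ∧ Meets y y' := by
  rw [Meets, tensorPoint_comp_dagger, comp_ne_zero_iff, and_comm]
  rfl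

variable [HasOrthogonalKernels C] [IsSeparatingBrick (𝟙_ C)] [HasLeftDual X]

theorem isAtomHom_tensorPoint {x : 𝟙_ C ⟶ X} {y : 𝟙_ C ⟶ Y} (hx : IsAtomHom x)
    (hy : IsAtomHom y) : IsAtomHom (tensorPoint x y) := by
  have hxy : Meets (tensorPoint x y) (tensorPoint x y) :=
    meets_tensorPoint.2 ⟨meets_self hx.1, meets_self hy.1⟩
  refine ⟨hxy.ne_zero, fun z hz => or_iff_not_imp_left.2 fun hz0 => hz.antisymm ?_⟩
  refine homLE_of_meets_tensorPoint fun x' y' h => ?_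
  obtain ⟨hx', hy'⟩ := meets_tensorPoint.1 h
  have hle : HomLE (tensorPoint x y) (tensorPoint x' y') :=
    homLE_of_meets_tensorPoint fun x₀ y₀ h₀ =>
      meets_tensorPoint.2 <| (meets_tensorPoint.1 h₀).imp
        (comp_ne_zero_of_homLE (hx.homLE_of_meets hx'))
        (comp_ne_zero_of_homLE (hy.homLE_of_meets hy'))
  exact (meets_of_homLE hz0 hz).mono (.refl z) hle

theorem exists_eq_tensorPoint [HasLeftDual Y] {z : 𝟙_ C ⟶ X ⊗ Y} (hz : IsAtomHom z) :
    ∃ x y, IsAtomHom x ∧ IsAtomHom y ∧ tensorPoint x y = z := by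
  obtain ⟨x, y, hxy⟩ := exists_meets_tensorPoint hz.1
  obtain ⟨b, hb, hxb⟩ : ∃ b, IsAtomHom b ∧ Meets z (tensorPoint x b) := by
    rw [tensorPoint_eq_left, meets_comp_right] at hxy
    obtain ⟨b, hb, hzb, -⟩ := exists_isAtomHom_of_meets hxy
    exact ⟨b, hb, by rwa [tensorPoint_eq_left, meets_comp_right]⟩
  obtain ⟨a, ha, hab⟩ : ∃ a, IsAtomHom a ∧ Meets z (tensorPoint a b) := by
    rw [tensorPoint_eq_right, meets_comp_right] at hxb
    obtain ⟨a, ha, hza, -⟩ := exists_isAtomHom_of_meets hxb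
    exact ⟨a, ha, by rwa [tensorPoint_eq_right, meets_comp_right]⟩
  exact ⟨a, b, ha, hb, ((hz.meets_iff_eq (isAtomHom_tensorPoint ha hb)).1 hab).symm⟩

end TensorAtoms

section AtomFunctor

variable {C : Type u} [Category.{v} C] [MonoidalCategory C] [DaggerCategory C]
  [HasDaggerBiproducts C] {X Y Z : C}

theorem atom_ext {x y : RelMon.El (atomObj X)} (h : atomPoint x = atomPoint y) : x = y :=
  Subtype.ext h

theorem isAtomHom_atomPoint (x : RelMon.El (atomObj X)) : IsAtomHom (atomPoint x) := x.2

theorem related_atomMap [IsBrick (𝟙_ C)] {f : X ⟶ Y} {x : RelMon.El (atomObj X)}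
    {y : RelMon.El (atomObj Y)} :
    RelMon.Related (atomMap f) x y ↔ Meets (atomPoint x ≫ f) (atomPoint y) := by
  rw [meets_iff, Category.assoc]
  rfl

theorem unitAtom_bijective [IsBrick (𝟙_ C)] :
    Function.Bijective (unitAtom (C := C) isAtomHom_id) :=
  ⟨fun _ _ _ => rfl, fun y =>
    ⟨PUnit.unit, atom_ext (eq_id_of_ne_zero (isAtomHom_atomPoint y).1).symm⟩⟩

variable [HasOrthogonalKernels C] [IsSeparatingBrick (𝟙_ C)]

theorem atomMap_iso_hom (f : X ≅ Y) :
    atomMap f.hom = RelMon.graphHom fun x => mkAtom (atomPoint x ≫ f.hom)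
      ((isAtomHom_atomPoint x).comp_iso f) := by
  apply RelMon.hom_ext
  intro x y
  rw [related_atomMap,
    ((isAtomHom_atomPoint x).comp_iso f).meets_iff_eq (isAtomHom_atomPoint y)]
  exact ⟨fun h => (atom_ext h : mkAtom _ _ = y), congrArg atomPoint⟩

theorem atomMap_id (X : C) : atomMap (𝟙 X) = 𝟙 (atomObj X) := by
  rw [← Iso.refl_hom, atomMap_iso_hom, RelMon.graph_id]
  exact congrArg RelMon.graphHom (funext fun x => atom_ext (Category.comp_id _))

theorem atomMap_comp [BraidedCategory C] [HasLeftDual Y] (r : X ⟶ Y) (s : Y ⟶ Z) :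
    atomMap (r ≫ s) = atomMap r ≫ atomMap s := by
  apply RelMon.hom_ext
  intro x z
  simp only [RelMon.related_comp, related_atomMap]
  constructor
  · intro h
    have hxz : Meets (atomPoint x ≫ r) (atomPoint z ≫ dagger s) := by
      rwa [meets_comp_right, dagger_dagger, Category.assoc]
    obtain ⟨y, hy, hxy, hyz⟩ := exists_isAtomHom_of_meets hxz
    rw [meets_comp_right, dagger_dagger] at hyz
    exact ⟨mkAtom y hy, hxy, hyz⟩
  · rintro ⟨y, hxy, hyz⟩
    have hle := (isAtomHom_atomPoint y).homLE_of_meets hxy.symm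
    rw [Meets, Category.assoc] at hyz
    simpa only [Meets, Category.assoc] using comp_ne_zero_of_homLE hle hyz

end AtomFunctor

section AtomMonoidal

variable {C : Type u} [Category.{v} C] [MonoidalCategory C] [SymmetricCategory C]
  [DaggerCategory C] [DaggerSymmetricMonoidal C] [LeftRigidCategory C] [HasDaggerBiproducts C]
  [HasOrthogonalKernels C] [IsSeparatingBrick (𝟙_ C)]

theorem isAtomHom_tensor_atomPoint {X Y : C} (x : RelMon.El (atomObj X))
    (y : RelMon.El (atomObj Y)) : IsAtomHom (tensorPoint (atomPoint x) (atomPoint y)) :=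
  isAtomHom_tensorPoint (isAtomHom_atomPoint x) (isAtomHom_atomPoint y)

theorem tensorAtom_bijective (X Y : C) :
    Function.Bijective (tensorAtom isAtomHom_tensor_atomPoint X Y) := by
  refine ⟨fun p q hpq => ?_, fun z => ?_⟩
  · have hmeets := ((isAtomHom_tensor_atomPoint _ _).meets_iff_eq
      (isAtomHom_tensor_atomPoint _ _)).2 (congrArg atomPoint hpq)
    obtain ⟨hfst, hsnd⟩ := meets_tensorPoint.1 hmeets
    exact (RelMon.prod_ext p q).2
      ⟨atom_ext (((isAtomHom_atomPoint _).meets_iff_eq (isAtomHom_atomPoint _)).1 hfst),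
        atom_ext (((isAtomHom_atomPoint _).meets_iff_eq (isAtomHom_atomPoint _)).1 hsnd)⟩
  · obtain ⟨x, y, hx, hy, hz⟩ := exists_eq_tensorPoint (isAtomHom_atomPoint z)
    exact ⟨RelMon.pair (mkAtom x hx) (mkAtom y hy), atom_ext hz⟩

theorem prodHom_atomMap_comp_tensorAtom {X X' Y Y' : C} (f : X ⟶ Y) (g : X' ⟶ Y') :
    RelMon.prodHom (atomMap f) (atomMap g) ≫
        RelMon.graphHom (tensorAtom isAtomHom_tensor_atomPoint Y Y') =
      RelMon.graphHom (tensorAtom isAtomHom_tensor_atomPoint X X') ≫ atomMap (f ⊗ₘ g) := by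
  refine RelMon.comp_graph_eq _ _ (Equiv.ofBijective _ (tensorAtom_bijective X X'))
    (Equiv.ofBijective _ (tensorAtom_bijective Y Y')) fun p q => ?_
  change RelMon.Related (atomMap f) (RelMon.fst p) (RelMon.fst q) ∧
    RelMon.Related (atomMap g) (RelMon.snd p) (RelMon.snd q) ↔
      RelMon.Related (atomMap (f ⊗ₘ g)) (tensorAtom isAtomHom_tensor_atomPoint X X' p)
        (tensorAtom isAtomHom_tensor_atomPoint Y Y' q)
  rw [related_atomMap, related_atomMap, related_atomMap, ← meets_tensorPoint, ← tensorPoint_comp]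
  rfl

theorem tensorAtom_comp_atomMap_associator (X Y Z : C) :
    RelMon.prodHom (RelMon.graphHom (tensorAtom isAtomHom_tensor_atomPoint X Y)) (𝟙 (atomObj Z)) ≫
        RelMon.graphHom (tensorAtom isAtomHom_tensor_atomPoint (X ⊗ Y) Z) ≫
          atomMap (α_ X Y Z).hom =
      (RelMon.assocIso (atomObj X) (atomObj Y) (atomObj Z)).hom ≫
        RelMon.prodHom (𝟙 (atomObj X))
            (RelMon.graphHom (tensorAtom isAtomHom_tensor_atomPoint Y Z)) ≫
          RelMon.graphHom (tensorAtom isAtomHom_tensor_atomPoint X (Y ⊗ Z)) := by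
  simp only [RelMon.assocIso, RelMon.equivIso, atomMap_iso_hom, RelMon.graph_id,
    RelMon.prodHom_graph, RelMon.graph_comp]
  exact congrArg RelMon.graphHom (funext fun _ => atom_ext (tensorPoint_associator _ _ _))

theorem unitAtom_tensorAtom_comp_atomMap_leftUnitor (X : C) :
    (RelMon.leftUnitIso (atomObj X)).hom =
      RelMon.prodHom (RelMon.graphHom (unitAtom isAtomHom_id)) (𝟙 (atomObj X)) ≫
        RelMon.graphHom (tensorAtom isAtomHom_tensor_atomPoint (𝟙_ C) X) ≫
          atomMap (λ_ X).hom := by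
  simp only [RelMon.leftUnitIso, RelMon.equivIso, atomMap_iso_hom, RelMon.graph_id,
    RelMon.prodHom_graph, RelMon.graph_comp]
  exact congrArg RelMon.graphHom (funext fun _ => atom_ext (tensorPoint_leftUnitor _).symm)

theorem tensorAtom_unitAtom_comp_atomMap_rightUnitor (X : C) :
    (RelMon.rightUnitIso (atomObj X)).hom =
      RelMon.prodHom (𝟙 (atomObj X)) (RelMon.graphHom (unitAtom isAtomHom_id)) ≫
        RelMon.graphHom (tensorAtom isAtomHom_tensor_atomPoint X (𝟙_ C)) ≫
          atomMap (ρ_ X).hom := by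
  simp only [RelMon.rightUnitIso, RelMon.equivIso, atomMap_iso_hom, RelMon.graph_id,
    RelMon.prodHom_graph, RelMon.graph_comp]
  exact congrArg RelMon.graphHom (funext fun _ => atom_ext (tensorPoint_rightUnitor _).symm)

theorem tensorAtom_comp_atomMap_braiding (X Y : C) :
    RelMon.graphHom (tensorAtom isAtomHom_tensor_atomPoint X Y) ≫ atomMap (β_ X Y).hom =
      (RelMon.swapIso (atomObj X) (atomObj Y)).hom ≫
        RelMon.graphHom (tensorAtom isAtomHom_tensor_atomPoint Y X) := by
  simp only [RelMon.swapIso, RelMon.equivIso, atomMap_iso_hom, RelMon.graph_comp]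
  exact congrArg RelMon.graphHom (funext fun _ => atom_ext (tensorPoint_braiding _ _))

variable (C) in
/-- The functor `E` to sets and relations as a strong monoidal functor. -/
noncomputable def atomCoreMonoidal :
    (atomFunctor (C := C) atomMap_id atomMap_comp).CoreMonoidal where
  εIso := RelMon.equivIso (Equiv.ofBijective _ unitAtom_bijective)
  μIso X Y := RelMon.equivIso (Equiv.ofBijective _ (tensorAtom_bijective X Y))
  μIso_hom_natural_left f X' := by
    have h := prodHom_atomMap_comp_tensorAtom f (𝟙 X')
    rwa [atomMap_id, tensorHom_id] at h
  μIso_hom_natural_right X' f := by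
    have h := prodHom_atomMap_comp_tensorAtom (𝟙 X') f
    rwa [atomMap_id, id_tensorHom] at h
  associativity := tensorAtom_comp_atomMap_associator
  left_unitality := unitAtom_tensorAtom_comp_atomMap_leftUnitor
  right_unitality := tensorAtom_unitAtom_comp_atomMap_rightUnitor

variable (C) in
/-- The functor `E` to sets and relations as a strong symmetric monoidal functor. -/
@[reducible]
noncomputable def atomFunctorBraided : (atomFunctor (C := C) atomMap_id atomMap_comp).Braided :=
  { (atomCoreMonoidal C).toMonoidal with
    braided := tensorAtom_comp_atomMap_braiding }

end AtomMonoidal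

/-- The duals of a dagger compact closed category, chosen for all objects at once. -/
@[reducible]
noncomputable def leftRigidCategory (C : Type u) [Category.{v} C] [MonoidalCategory C]
    [SymmetricCategory C] [DaggerCategory C] [DaggerCompactClosed C] : LeftRigidCategory C where
  leftDual X :=
    { leftDual := (DaggerCompactClosed.hasDaggerDual X).choose
      exact := (DaggerCompactClosed.hasDaggerDual X).choose_spec.choose }

end DaggerCategory

theorem proposition9_general {C : Type u} [Category.{v} C] [MonoidalCategory C]
    [SymmetricCategory C] [DaggerCategory C] [DaggerSymmetricMonoidal C] [LeftRigidCategory C]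
    [HasDaggerBiproducts C] [HasOrthogonalKernels C] [IsSeparatingBrick (𝟙_ C)] :
    ∃ (hid : ∀ X : C, atomMap (𝟙 X) = 𝟙 (atomObj X))
      (hcomp : ∀ {X Y Z : C} (r : X ⟶ Y) (s : Y ⟶ Z), atomMap (r ≫ s) = atomMap r ≫ atomMap s)
      (hone : IsAtomHom (𝟙 (𝟙_ C)))
      (htensor : ∀ {X Y : C} (x : RelMon.El (atomObj X)) (y : RelMon.El (atomObj Y)),
        IsAtomHom (tensorPoint (atomPoint x) (atomPoint y))),
      (∀ X Y : C, Function.Bijective (tensorAtom htensor X Y)) ∧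
      ∃ _ : (atomFunctor hid hcomp).Braided,
        Functor.LaxMonoidal.ε (atomFunctor hid hcomp) = RelMon.graphHom (unitAtom hone) ∧
        ∀ X Y : C, Functor.LaxMonoidal.μ (atomFunctor hid hcomp) X Y =
          RelMon.graphHom (tensorAtom htensor X Y) :=
  ⟨atomMap_id, atomMap_comp, isAtomHom_id, isAtomHom_tensor_atomPoint, tensorAtom_bijective,
    atomFunctorBraided C, rfl, fun _ _ => rfl⟩

theorem proposition9 {C : Type u} [Category.{v} C] [MonoidalCategory C] [SymmetricCategory C]
    [DaggerCategory C] [DaggerCompactClosed C]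
    -- each family of objects has a dagger biproduct
    [HasDaggerBiproducts C]
    -- each morphism has a kernel that is dagger monic
    (hker : ∀ {X Y : C} (f : X ⟶ Y), ∃ (K : C) (k : K ⟶ X), IsDaggerMonic k ∧ IsKernelOf k f)
    -- a dagger kernel and its complement are jointly epic
    (hepi : ∀ {K K' X : C} (k : K ⟶ X) (k' : K' ⟶ X),
      IsDaggerKernel k → IsComplement k' k → JointlyEpic k k')
    (hI : ¬ IsZero (𝟙_ C))
    (hinv : ∀ f : 𝟙_ C ⟶ 𝟙_ C, f ≠ 0 → IsIso f)
    (hsep : IsSeparator (𝟙_ C)) :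
    -- `E` is a functor, and the functions `* ↦ 1` and `(x, y) ↦ x ⊗ y` take values in atoms
    ∃ (hid : ∀ X : C, atomMap (𝟙 X) = 𝟙 (atomObj X))
      (hcomp : ∀ {X Y Z : C} (r : X ⟶ Y) (s : Y ⟶ Z), atomMap (r ≫ s) = atomMap r ≫ atomMap s)
      (hone : IsAtomHom (𝟙 (𝟙_ C)))
      (htensor : ∀ {X Y : C} (x : RelMon.El (atomObj X)) (y : RelMon.El (atomObj Y)),
        IsAtomHom (tensorPoint (atomPoint x) (atomPoint y))),
      (∀ X Y : C, Function.Bijective (tensorAtom htensor X Y)) ∧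
      -- `E` is strong symmetric monoidal with these structure maps
      ∃ _ : (atomFunctor hid hcomp).Braided,
        Functor.LaxMonoidal.ε (atomFunctor hid hcomp) = RelMon.graphHom (unitAtom hone) ∧
        ∀ X Y : C, Functor.LaxMonoidal.μ (atomFunctor hid hcomp) X Y =
          RelMon.graphHom (tensorAtom htensor X Y) := by
  have : HasOrthogonalKernels C := ⟨hker, hepi⟩
  have : IsSeparatingBrick (𝟙_ C) :=
    { not_isZero := hI, isIso_of_ne_zero := hinv, isSeparator := hsep }
  let _ := leftRigidCategory C
  exact proposition9_general
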